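/- Stavskaya's automaton acts on bit strings $b$ on a one-dimensional lattice ($b_x=1$ means an error at $x$) by the simultaneous update $b_x\mapsto\min(b_x,b_{x+1})$; let $K$ be the corresponding operator on probability distributions. With maximally up-biased noise of strength $\epsilon$, one time step is $K_\epsilon=K\prod_x(1+\epsilon v_x)$ with $v_x=\sigma_x^+-\sigma_x^-\sigma_x^+$: first, independently at each site, a $0$ is turned into a $1$ with probability $\epsilon$ (a $1$ is left alone), and then $K$ is applied. Let $0\le\epsilon<6^{-3}$, let the initial state be the error-free configuration $\vec 0$, and let $t\ge 0$ be an integer. For a finite set $\Lambda$ of sites (not necessarily contiguous) let $\vec\Lambda$ be the configuration with errors precisely on $\Lambda$. Then: 1. (Periodic ring.) For every $L\ge1$ and every set $\Lambda$ of sites of the periodic ring $\mathbb Z/L\mathbb Z$ other than the whole ring, $$\mathbb P(b_t=\vec\Lambda)=\langle\vec\Lambda|K_\epsilon^t|\vec 0\rangle\le(6\epsilon)^{|\Lambda|}.$$ The bound is uniform in $L$ and $t$. 2. (Thermodynamic limit.) On the infinite chain $\mathbb Z$, for every finite $\Lambda\subset\mathbb Z$, $\mathbb P(b_t=\vec\Lambda)\le(6\epsilon)^{|\Lambda|}$,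 and moreover the probability of having errors at all sites of $\Lambda$ (and possibly elsewhere) satisfies $$\mathbb P(b_{t,x}=1\ \text{for all }x\in\Lambda)\le(6\epsilon)^{|\Lambda|}.$$ -/

import Mathlib

open MeasureTheory

noncomputable section

namespace Stavskaya

/-- A bit string on the lattice `X`; `true` (that is, `1`) at `x` means an error at `x`. -/
abbrev Config (X : Type) : Type := X → Bool

/-- The configuration with errors precisely on `Λ`. -/
def errorsOn {X : Type} [DecidableEq X] (Λ : Finset X) : Config X := fun x => decide (x ∈ Λ)

/-- Stavskaya's deterministic update `b_x → min (b_x, b_{x+1})`, all sites at once. It is used on the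
periodic ring `ZMod L` and on the infinite chain `ℤ`. -/
def update {X : Type} [Add X] [One X] (b : Config X) : Config X := fun x => min (b x) (b (x + 1))

/-! ### The ring with `L` sites

Operators are real matrices `M`, with `M b' b` the matrix element `⟨b'| M |b⟩`; they act on column
vectors, so that in a product the right-hand factor acts first. -/

/-- One-site raising operator: `σ⁺ |0⟩ = |1⟩`, `σ⁺ |1⟩ = 0`. -/
def sigmaPlus : Matrix Bool Bool ℝ := Matrix.single true false 1

/-- One-site lowering operator: `σ⁻ |1⟩ = |0⟩`, `σ⁻ |0⟩ = 0`. -/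
def sigmaMinus : Matrix Bool Bool ℝ := Matrix.single false true 1

/-- The one-site generator `v = σ⁺ - σ⁻ σ⁺` of maximally up-biased noise. -/
def upGenerator : Matrix Bool Bool ℝ := sigmaPlus - sigmaMinus * sigmaPlus

/-- The operator `∏_x (1 + ε v_x)` on the ring. The factors act on different sites, so the matrix
elements of the product are the products of the one-site matrix elements. -/
def ringNoise (L : ℕ) [NeZero L] (ε : ℝ) : Matrix (Config (ZMod L)) (Config (ZMod L)) ℝ :=
  Matrix.of fun b' b => ∏ x : ZMod L, (1 + ε • upGenerator) (b' x) (b x)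

/-- The dynamical map `K` of the deterministic automaton on the ring, `K |b⟩ = |update b⟩`. -/
def ringK (L : ℕ) [NeZero L] : Matrix (Config (ZMod L)) (Config (ZMod L)) ℝ :=
  Matrix.of fun b' b => if b' = update b then 1 else 0

/-- The perturbed Markov map `K_ε = K ∏_x (1 + ε v_x)` on the ring. -/
def ringKEps (L : ℕ) [NeZero L] (ε : ℝ) : Matrix (Config (ZMod L)) (Config (ZMod L)) ℝ :=
  ringK L * ringNoise L ε

/-! ### The infinite chain `ℤ`

States are probability measures on configurations, with the product σ-algebra. -/

/-- Law of the noise in one time step: independently at each site, `1` with probability `ε`. -/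
def flipLaw (ε : unitInterval) : Measure (Config ℤ) :=
  Measure.infinitePi fun _ : ℤ => ProbabilityTheory.bernoulliMeasure true false ε

/-- Up-biased noise on the infinite chain: independently at each site, `0` becomes `1` with
probability `ε`, while `1` is left unchanged. -/
def chainNoise (ε : unitInterval) (μ : Measure (Config ℤ)) : Measure (Config ℤ) :=
  (μ.prod (flipLaw ε)).map fun p x => max (p.1 x) (p.2 x)

/-- The perturbed Markov map `K_ε` on the infinite chain: noise, then the deterministic update. -/
def chainKEps (ε : unitInterval) (μ : Measure (Config ℤ)) : Measure (Config ℤ) :=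
  (chainNoise ε μ).map update

/-- The law at time `t` on the infinite chain, started from the error-free configuration. -/
def chainLaw (ε : unitInterval) (t : ℕ) : Measure (Config ℤ) :=
  (chainKEps ε)^[t] (Measure.dirac (errorsOn ∅))

end Stavskaya

end

noncomputable section

namespace Stavskaya

/-! A Peierls argument. Let `F` be the history of flips, and let `V` be the sites of a window around
`Λ` that are not required to carry errors. If the gaps reachable from the left end of the window did
not include its right end, a site outside `V` at the border of the reachable part would be
error-free (`eq_false_of_reflTransGen`). Errors on `Λ` therefore force a `Step` path across the
window.

Made self-avoiding, the path crosses `f` distinct flipped sites, goes up `p` times and down `p`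
times, and crosses at most `|V|` sites for free. Its displacement gives `f - p ≥ |Λ|`, so its word,
of length `m = f + 2p`, satisfies `2|Λ| + m ≤ 3f`. For `ε < 6⁻³` the required flips have probability
`ε ^ f ≤ (6ε) ^ |Λ| * 6⁻ᵐ`. There are `3 ^ m` words of length `m`, and `∑_{m ≥ 1} 2⁻ᵐ = 1`
(`historyLaw_le_of_exists_word`).

On the ring the path lives on the universal cover `ℤ`. An error-free site yields an unflipped path
back to time `0`; its lifts confine the dual path to a strip of width `L`, where the projection is
injective (`exists_word_ring`). -/

/-! ### Paths -/

/-- A self-avoiding path of the relation `r`, with its set of vertices other than the endpoint. -/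
inductive SimplePath {α : Type} [DecidableEq α] (r : α → α → Prop) (c : α) :
    α → Finset α → Prop
  | nil : SimplePath r c c ∅
  | cons {u v : α} {A : Finset α} :
      r u v → SimplePath r c v A → u ∉ A → SimplePath r c u (insert u A)

lemma SimplePath.exists_of_mem {α : Type} [DecidableEq α] {r : α → α → Prop} {c v : α}
    {A : Finset α} (h : SimplePath r c v A) {u : α} (hu : u ∈ A) :
    ∃ A', SimplePath r c u A' := by
  induction h with
  | nil => simp at hu
  | cons hr hp hn ih =>
    rcases Finset.mem_insert.1 hu with rfl | h
    · exact ⟨_, .cons hr hp hn⟩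
    · exact ih h

/-- Loop erasure: a vertex that is already on the path restarts it from there. -/
lemma SimplePath.exists_of_reflTransGen {α : Type} [DecidableEq α] {r : α → α → Prop} {c u : α}
    (h : Relation.ReflTransGen r u c) : ∃ A, SimplePath r c u A := by
  induction h using Relation.ReflTransGen.head_induction_on with
  | refl => exact ⟨_, .nil⟩
  | @head u v hr _ ih =>
    obtain ⟨A, hA⟩ := ih
    by_cases hu : u ∈ A
    · exact hA.exists_of_mem hu
    · exact ⟨_, .cons hr hA hu⟩

lemma SimplePath.reflTransGen {α : Type} [DecidableEq α] {r : α → α → Prop} {c u : α}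
    {A : Finset α} (h : SimplePath r c u A) : Relation.ReflTransGen r u c := by
  induction h with
  | nil => exact .refl
  | cons hr _ _ ih => exact .head hr ih

lemma SimplePath.reflTransGen_of_mem {α : Type} [DecidableEq α] {r : α → α → Prop} {c u y : α}
    {A : Finset α} (h : SimplePath r c u A) (hy : y ∈ A) :
    Relation.ReflTransGen r u y ∧ Relation.ReflTransGen r y c := by
  induction h with
  | nil => simp at hy
  | cons hr hp hn ih =>
    rcases Finset.mem_insert.1 hy with rfl | h
    · exact ⟨.refl, .head hr hp.reflTransGen⟩
    · exact ⟨.head hr (ih h).1, (ih h).2⟩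

/-! ### The automaton with prescribed flips and its dual graph -/

section Dual

variable {X : Type} [Ring X]

/-- The state at time `t` when the noise at time `s` flips the sites where `F s` is `true`. -/
def evolve (F : ℕ → Config X) : ℕ → Config X
  | 0 => fun _ => false
  | t + 1 => update fun x => max (evolve F t x) (F t x)

lemma evolve_succ_eq_false {F : ℕ → Config X} {t : ℕ} {x : X} :
    evolve F (t + 1) x = false ↔
      (evolve F t x = false ∧ F t x = false) ∨
        (evolve F t (x + 1) = false ∧ F t (x + 1) = false) := by
  simp only [evolve, update]
  cases evolve F t x <;> cases F t x <;> cases evolve F t (x + 1) <;> cases F t (x + 1) <;> decide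

/-- Steps between the gaps `(x, s)`, to the left of site `x` at time `s`. A flipped site can be
crossed to the right, and so can the sites of `V` at the final time `t`; the other steps follow the
boundary of the region that influences a site. -/
inductive Step (F : ℕ → Config X) (V : Finset ℤ) (t : ℕ) : ℤ × ℕ → ℤ × ℕ → Prop
  | flip {x : ℤ} {s : ℕ} : s < t → F s (x : X) = true → Step F V t (x, s) (x + 1, s)
  | skip {x : ℤ} : x ∈ V → Step F V t (x, t) (x + 1, t)
  | down {x : ℤ} {s : ℕ} : s < t → (s + 1 = t → x ∉ V) → Step F V t (x, s + 1) (x, s)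
  | up {x : ℤ} {s : ℕ} : s < t → Step F V t (x, s) (x - 1, s + 1)

variable {F : ℕ → Config X} {V : Finset ℤ} {t : ℕ}

open Relation in
/-- If the dual path is blocked at a site, then that site carries no error. -/
lemma eq_false_of_reflTransGen {u : ℤ × ℕ} {s : ℕ} (hs : s ≤ t) {x : ℤ}
    (hx : ReflTransGen (Step F V t) u (x, s)) (hx' : ¬ ReflTransGen (Step F V t) u (x + 1, s))
    (hV : s = t → x ∉ V) :
    evolve F s (x : X) = false ∧ (s < t → F s (x : X) = false) := by
  induction s generalizing x with
  | zero =>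
    refine ⟨rfl, fun h => ?_⟩
    by_contra hF
    exact hx' (hx.tail (.flip h (by simpa using hF)))
  | succ s ih =>
    constructor
    · rw [evolve_succ_eq_false]
      have hd : ReflTransGen (Step F V t) u (x, s) := hx.tail (.down hs hV)
      by_cases h1 : ReflTransGen (Step F V t) u (x + 1, s)
      · have h2 : ¬ ReflTransGen (Step F V t) u (x + 1 + 1, s) := fun h => hx' (by
          simpa using h.tail (.up hs))
        have := ih (by omega) h1 h2 (by omega)
        push_cast at this
        exact .inr ⟨this.1, this.2 hs⟩
      · have := ih (by omega) hd h1 (by omega)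
        exact .inl ⟨this.1, this.2 hs⟩
    · intro h
      by_contra hF
      exact hx' (hx.tail (.flip h (by simpa using hF)))

open Relation in
lemma reflTransGen_of_errors {a : ℤ} {n : ℕ}
    (h : ∀ x : ℤ, a ≤ x → x < a + n → x ∉ V → evolve F t (x : X) = true) :
    ReflTransGen (Step F V t) (a, t) (a + n, t) := by
  induction n with
  | zero => simpa using ReflTransGen.refl
  | succ n ih =>
    have h0 := ih fun x hx hx' => h x hx (by push_cast; omega)
    by_contra hc
    have hc' : ¬ ReflTransGen (Step F V t) (a, t) (a + n + 1, t) := by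
      simpa [add_assoc] using hc
    have hV : a + n ∉ V := fun hV => hc' (h0.tail (.skip hV))
    have h1 := (eq_false_of_reflTransGen le_rfl h0 hc' fun _ => hV).1
    rw [h _ (by omega) (by push_cast; omega) hV] at h1
    exact Bool.noConfusion h1

/-! ### Encoding of paths by words -/

/-- Advance through the sites of `V` at time `t`. -/
def advance (V : Finset ℤ) (t : ℕ) (v : ℤ × ℕ) : ℤ × ℕ :=
  if v.2 = t then (sInf {y | v.1 ≤ y ∧ y ∉ V}, t) else v

lemma advance_of_lt {v : ℤ × ℕ} (h : v.2 < t) : advance V t v = v := if_neg h.ne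

lemma advance_of_notMem {x : ℤ} {s : ℕ} (h : s = t → x ∉ V) : advance V t (x, s) = (x, s) := by
  unfold advance
  split_ifs with hs
  · have : IsLeast {y | x ≤ y ∧ y ∉ V} x := ⟨⟨le_rfl, h hs⟩, fun y hy => hy.1⟩
    simp only at hs ⊢
    rw [this.csInf_eq, hs]
  · rfl

lemma advance_succ {x : ℤ} (h : x ∈ V) : advance V t (x, t) = advance V t (x + 1, t) := by
  have : {y | x ≤ y ∧ y ∉ V} = {y | x + 1 ≤ y ∧ y ∉ V} := by
    ext y
    constructor
    · rintro ⟨h1, h2⟩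
      refine ⟨?_, h2⟩
      rcases h1.eq_or_lt with rfl | h1
      · exact absurd h h2
      · exact h1
    · rintro ⟨h1, h2⟩
      exact ⟨by omega, h2⟩
  simp [advance, this]

/-- The flipped sites crossed by the path with steps `w`: `0` crosses a flipped site, `1` goes down,
`2` goes up; the sites of `V` at time `t` are crossed without being mentioned in `w`. -/
def crossed (V : Finset ℤ) (t : ℕ) : ℤ × ℕ → List (Fin 3) → List (ℤ × ℕ)
  | _, [] => []
  | v, 0 :: w =>
    advance V t v :: crossed V t ((advance V t v).1 + 1, (advance V t v).2) w
  | v, 1 :: w => crossed V t ((advance V t v).1, (advance V t v).2 - 1) w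
  | v, 2 :: w => crossed V t ((advance V t v).1 - 1, (advance V t v).2 + 1) w

lemma crossed_congr {u v : ℤ × ℕ} (h : advance V t u = advance V t v) (w : List (Fin 3)) :
    crossed V t u w = crossed V t v w := by
  match w with
  | [] => rfl
  | 0 :: w => simp only [crossed, h]
  | 1 :: w => simp only [crossed, h]
  | 2 :: w => simp only [crossed, h]

/-- Three letters suffice because at a site of `V` at time `t` the only possible step is `skip`.
Self-avoidance makes the crossed flips distinct and lets `T` collect the skipped sites without
repetition; `p` and `d` count the `up` and `down` steps. -/
lemma SimplePath.exists_word {c u : ℤ × ℕ} {A : Finset (ℤ × ℕ)}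
    (h : SimplePath (Step F V t) c u A) :
    ∃ (w : List (Fin 3)) (T : Finset ℤ) (p d : ℕ),
      (crossed V t u w).Nodup ∧ (∀ y ∈ crossed V t u w, y ∈ A ∧ F y.2 (y.1 : X) = true) ∧
      T ⊆ V ∧ (∀ x ∈ T, (x, t) ∈ A) ∧
      w.length = (crossed V t u w).length + p + d ∧
      c.1 + p = u.1 + (crossed V t u w).length + T.card ∧ c.2 + d = u.2 + p := by
  induction h with
  | nil => exact ⟨[], ∅, 0, 0, by simp [crossed]⟩
  | @cons u v A hr hp hn ih =>
    obtain ⟨w, T, p, d, h1, h2, h3, h4, h5, h6, h7⟩ := ih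
    cases hr with
    | @flip x s hs hF =>
      have e : crossed V t (x, s) (0 :: w) = (x, s) :: crossed V t (x + 1, s) w := by
        simp [crossed, advance_of_lt (V := V) (v := (x, s)) hs]
      refine ⟨0 :: w, T, p, d, ?_, ?_, h3, ?_, ?_, ?_, ?_⟩
      · rw [e]; exact List.nodup_cons.2 ⟨fun h => hn (h2 _ h).1, h1⟩
      · rw [e]
        intro y hy
        rcases List.mem_cons.1 hy with rfl | hy
        · exact ⟨Finset.mem_insert_self _ _, hF⟩
        · exact ⟨Finset.mem_insert_of_mem (h2 y hy).1, (h2 y hy).2⟩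
      · exact fun y hy => Finset.mem_insert_of_mem (h4 y hy)
      · rw [e]; simp only [List.length_cons]; omega
      · rw [e]; simp only [List.length_cons] at h6 ⊢; push_cast; omega
      · exact h7
    | @skip x hV =>
      have e := crossed_congr (advance_succ (t := t) hV) w
      have hx : x ∉ T := fun hx => hn (h4 x hx)
      refine ⟨w, insert x T, p, d, by rwa [e], ?_, ?_, ?_, by rwa [e], ?_, h7⟩
      · rw [e]; exact fun y hy => ⟨Finset.mem_insert_of_mem (h2 y hy).1, (h2 y hy).2⟩
      · exact Finset.insert_subset hV h3
      · intro y hy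
        rcases Finset.mem_insert.1 hy with rfl | hy
        · exact Finset.mem_insert_self _ _
        · exact Finset.mem_insert_of_mem (h4 y hy)
      · rw [e, Finset.card_insert_of_notMem hx]; push_cast at h6 ⊢; omega
    | @down x s hs hV =>
      have e : crossed V t (x, s + 1) (1 :: w) = crossed V t (x, s) w := by
        simp [crossed, advance_of_notMem hV]
      refine ⟨1 :: w, T, p, d + 1, by rwa [e], ?_, h3, ?_, ?_, by rwa [e], ?_⟩
      · rw [e]; exact fun y hy => ⟨Finset.mem_insert_of_mem (h2 y hy).1, (h2 y hy).2⟩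
      · exact fun y hy => Finset.mem_insert_of_mem (h4 y hy)
      · rw [e]; simp only [List.length_cons]; omega
      · simp only at h7 ⊢; omega
    | @up x s hs =>
      have e : crossed V t (x, s) (2 :: w) = crossed V t (x - 1, s + 1) w := by
        simp [crossed, advance_of_lt (V := V) (v := (x, s)) hs]
      refine ⟨2 :: w, T, p + 1, d, by rwa [e], ?_, h3, ?_, ?_, ?_, ?_⟩
      · rw [e]; exact fun y hy => ⟨Finset.mem_insert_of_mem (h2 y hy).1, (h2 y hy).2⟩
      · exact fun y hy => Finset.mem_insert_of_mem (h4 y hy)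
      · rw [e]; simp only [List.length_cons]; omega
      · rw [e]; simp only at h6 ⊢; push_cast; omega
      · simp only at h7 ⊢; omega

/-- The projection of a space-time site to the lattice `X`. -/
def project (X : Type) [Ring X] (y : ℤ × ℕ) : ℕ × X := (y.2, (y.1 : X))

/-- Lattice sites crossed by the path with steps `w` that starts in the gap `(a, t)`. -/
def crossedSites (X : Type) [Ring X] [DecidableEq X] (V : Finset ℤ) (t : ℕ) (a : ℤ)
    (w : List (Fin 3)) : Finset (ℕ × X) :=
  ((crossed V t (a, t) w).map (project X)).toFinset

/-- Both ends lie at time `t`, so `p = d`, and the displacement `N` equals `f + |T| - p` with `|T| ≤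
|V|`. Injectivity, needed only between the two ends of the path, keeps the `f` flips distinct on the
lattice. -/
lemma exists_word [DecidableEq X] {a : ℤ} {N : ℕ} (hV : V ⊆ Finset.Ico a (a + N))
    (h : ∀ x ∈ Finset.Ico a (a + N) \ V, evolve F t (x : X) = true)
    (hinj : ∀ y y' : ℤ × ℕ,
      Relation.ReflTransGen (Step F V t) (a, t) y →
      Relation.ReflTransGen (Step F V t) y (a + N, t) →
      Relation.ReflTransGen (Step F V t) (a, t) y' →
      Relation.ReflTransGen (Step F V t) y' (a + N, t) → project X y = project X y' → y = y') :
    ∃ w : List (Fin 3),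
      2 * (Finset.Ico a (a + N) \ V).card + w.length ≤ 3 * (crossedSites X V t a w).card ∧
      (crossedSites X V t a w).card ≤ w.length ∧
      ∀ y ∈ crossedSites X V t a w, F y.1 y.2 = true := by
  obtain ⟨A, hA⟩ := SimplePath.exists_of_reflTransGen (reflTransGen_of_errors (F := F) (V := V)
    (t := t) (a := a) (n := N) fun x h1 h2 h3 => h x (by simp [h1, h2, h3]))
  obtain ⟨w, T, p, d, h1, h2, h3, -, h5, h6, h7⟩ := hA.exists_word
  have hcard : (crossedSites X V t a w).card = (crossed V t (a, t) w).length := by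
    rw [crossedSites, List.toFinset_card_of_nodup, List.length_map]
    refine h1.map_on fun y hy y' hy' => ?_
    obtain ⟨r1, r2⟩ := hA.reflTransGen_of_mem (h2 y hy).1
    obtain ⟨r3, r4⟩ := hA.reflTransGen_of_mem (h2 y' hy').1
    exact hinj y y' r1 r2 r3 r4
  have hT := Finset.card_le_card h3
  have hN := Finset.card_sdiff_add_card_eq_card hV
  rw [Int.card_Ico] at hN
  simp only at h6 h7
  refine ⟨w, by omega, by omega, fun y hy => ?_⟩
  simp only [crossedSites, List.mem_toFinset, List.mem_map] at hy
  obtain ⟨z, hz, rfl⟩ := hy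
  exact (h2 z hz).2

end Dual

/-! ### The infinite chain and the ring -/

lemma exists_word_chain {F : ℕ → Config ℤ} {t : ℕ} {a : ℤ} {N : ℕ} {Λ : Finset ℤ}
    (hΛ : Λ ⊆ Finset.Ico a (a + N)) (h : ∀ x ∈ Λ, evolve F t x = true) :
    ∃ w : List (Fin 3),
      2 * Λ.card + w.length ≤ 3 * (crossedSites ℤ (Finset.Ico a (a + N) \ Λ) t a w).card ∧
      (crossedSites ℤ (Finset.Ico a (a + N) \ Λ) t a w).card ≤ w.length ∧
      ∀ y ∈ crossedSites ℤ (Finset.Ico a (a + N) \ Λ) t a w, F y.1 y.2 = true := by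
  have e : Finset.Ico a (a + N) \ (Finset.Ico a (a + N) \ Λ) = Λ := by
    rw [Finset.sdiff_sdiff_eq_self hΛ]
  have := exists_word (X := ℤ) (F := F) (t := t) (a := a) (N := N)
    (V := Finset.Ico a (a + N) \ Λ) Finset.sdiff_subset (by rw [e]; simpa using h)
    (fun y y' _ _ _ _ hp => by
      simp only [project, Prod.mk.injEq, Int.cast_id] at hp
      exact Prod.ext hp.2 hp.1)
  rwa [e] at this

section Ring

variable {X : Type} [Ring X]

/-- An error-free site at time `t` is connected to the initial time by error-free, unflipped
sites. -/
lemma exists_unflipped_path {F : ℕ → Config X} {t : ℕ} {x : ℤ} (h : evolve F t (x : X) = false) :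
    ∃ z : ℕ → ℤ, z t = x ∧ ∀ s < t, (z s = z (s + 1) ∨ z s = z (s + 1) + 1) ∧
      F s (z s : X) = false := by
  induction t generalizing x with
  | zero => exact ⟨fun _ => x, rfl, by simp⟩
  | succ t ih =>
    obtain ⟨x', hx', h1, h2⟩ : ∃ x', (x' = x ∨ x' = x + 1) ∧ evolve F t (x' : X) = false ∧
        F t (x' : X) = false := by
      rcases evolve_succ_eq_false.1 h with h | h
      · exact ⟨x, .inl rfl, h⟩
      · exact ⟨x + 1, .inr rfl, by push_cast; exact h⟩
    obtain ⟨z, hz, hz'⟩ := ih h1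
    refine ⟨Function.update z (t + 1) x, by simp, fun s hs => ?_⟩
    rcases (Nat.lt_succ_iff.1 hs).eq_or_lt with rfl | hs
    · simpa [Function.update_apply, hz, h2] using hx'
    · have e1 : s ≠ t + 1 := by omega
      have e2 : s ≠ t := by omega
      simpa [Function.update_apply, e1, e2] using hz' s hs

/-- The dual path cannot cross an unflipped path to the right. -/
lemma le_of_reflTransGen {F : ℕ → Config X} {V : Finset ℤ} {t : ℕ} {z : ℕ → ℤ} (hV : z t ∉ V)
    (hz : ∀ s < t, (z s = z (s + 1) ∨ z s = z (s + 1) + 1) ∧ F s (z s : X) = false)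
    {u v : ℤ × ℕ} (h : Relation.ReflTransGen (Step F V t) u v) (hu : u.1 ≤ z u.2) :
    v.1 ≤ z v.2 := by
  induction h with
  | refl => exact hu
  | tail _ hs ih =>
    cases hs with
    | @flip x s hs hF =>
      simp only at ih ⊢
      rcases ih.eq_or_lt with rfl | ih
      · rw [(hz s hs).2] at hF; exact Bool.noConfusion hF
      · exact ih
    | @skip x hx =>
      simp only at ih ⊢
      rcases ih.eq_or_lt with rfl | ih
      · exact absurd hx hV
      · exact ih
    | @down x s hs _ => have := (hz s hs).1; simp only at ih ⊢; omega
    | @up x s hs => have := (hz s hs).1; simp only at ih ⊢; omega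

end Ring

lemma exists_word_ring {L : ℕ} [NeZero L] {F : ℕ → Config (ZMod L)} {t : ℕ} {a : ℤ}
    {V : Finset ℤ} (hV : V ⊆ Finset.Ico a (a + (L - 1 : ℕ)))
    (h : ∀ x ∈ Finset.Ico a (a + (L - 1 : ℕ)) \ V, evolve F t (x : ZMod L) = true)
    (ha : evolve F t ((a - 1 : ℤ) : ZMod L) = false) :
    ∃ w : List (Fin 3),
      2 * (Finset.Ico a (a + (L - 1 : ℕ)) \ V).card + w.length
        ≤ 3 * (crossedSites (ZMod L) V t a w).card ∧
      (crossedSites (ZMod L) V t a w).card ≤ w.length ∧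
      ∀ y ∈ crossedSites (ZMod L) V t a w, F y.1 y.2 = true := by
  have hL : 1 ≤ L := NeZero.one_le
  refine exists_word hV h ?_
  obtain ⟨z, hzt, hz⟩ := exists_unflipped_path ha
  have hmem : ∀ x ∈ V, a ≤ x ∧ x < a + (L - 1 : ℕ) := fun x hx => by simpa using hV hx
  have key : ∀ y : ℤ × ℕ, Relation.ReflTransGen (Step F V t) (a, t) y →
      Relation.ReflTransGen (Step F V t) y (a + (L - 1 : ℕ), t) →
      z y.2 < y.1 ∧ y.1 ≤ z y.2 + L := by
    intro y h1 h2
    -- Left of the barrier `z` the right end would be out of reach; the barrier shifted by `L` has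
    -- the same projection and bounds the path from the right.
    constructor
    · by_contra hc
      have := le_of_reflTransGen (fun h => by have := hmem _ h; omega) hz h2 (not_lt.1 hc)
      simp only at this
      omega
    · refine le_of_reflTransGen (z := fun s => z s + L) (fun h => ?_) (fun s hs => ?_) h1 ?_
      · have := hmem _ h; omega
      · obtain ⟨h3, h4⟩ := hz s hs
        exact ⟨by omega, by simpa using h4⟩
      · simp only; omega
  intro y y' h1 h2 h3 h4 hp
  simp only [project, Prod.mk.injEq] at hp
  obtain ⟨hs, hx⟩ := hp
  have k1 := key y h1 h2
  have k2 := key y' h3 h4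
  rw [← hs] at k2
  rw [ZMod.intCast_eq_intCast_iff_dvd_sub] at hx
  -- Both points lie in the interval `(z s, z s + L]`, which meets each residue class once.
  have : y'.1 - y.1 = 0 := Int.eq_zero_of_abs_lt_dvd hx (by rw [abs_lt]; omega)
  exact Prod.ext (by omega) hs

/-! ### Noise histories -/

section History

variable (X : Type) (ε : unitInterval)

/-- Law of the flips in one time step on the lattice `X`. -/
def noiseLaw : Measure (Config X) :=
  Measure.infinitePi fun _ : X => ProbabilityTheory.bernoulliMeasure true false ε

/-- Law of the flips at all times. -/
def historyLaw : Measure (ℕ → Config X) := Measure.infinitePi fun _ : ℕ => noiseLaw X ε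

instance : IsProbabilityMeasure (noiseLaw X ε) := by unfold noiseLaw; infer_instance

instance : IsProbabilityMeasure (historyLaw X ε) := by unfold historyLaw; infer_instance

variable {X}

lemma historyLaw_forall_mem (S : Finset (ℕ × X)) :
    historyLaw X ε {F | ∀ p ∈ S, F p.1 p.2 = true} = ENNReal.ofReal ((ε : ℝ) ^ S.card) := by
  have e : {F : ℕ × X → Bool | ∀ p ∈ S, F p = true} = Set.pi S fun _ => {true} := by
    ext; simp [Set.mem_pi]
  have hS : MeasurableSet {F : ℕ × X → Bool | ∀ p ∈ S, F p = true} := by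
    rw [e]; exact MeasurableSet.pi S.countable_toSet fun _ _ => measurableSet_singleton _
  have hS' : MeasurableSet {F : ℕ → Config X | ∀ p ∈ S, F p.1 p.2 = true} :=
    (MeasurableEquiv.curry ℕ X Bool).symm.measurable hS
  rw [historyLaw]
  simp only [noiseLaw]
  rw [← Measure.infinitePi_map_curry
    (fun (_ : ℕ) (_ : X) => ProbabilityTheory.bernoulliMeasure true false ε),
    Measure.map_apply (MeasurableEquiv.curry ℕ X Bool).measurable hS']
  change Measure.infinitePi _ {F : ℕ × X → Bool | ∀ p ∈ S, F p = true} = _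
  rw [e, Measure.infinitePi_pi _ fun _ _ => measurableSet_singleton _, Finset.prod_const,
    ENNReal.ofReal_pow ε.2.1]
  congr 1
  rw [ProbabilityTheory.bernoulliMeasure_apply_of_mem_of_notMem _ (by simp) (by simp)]
  · rw [ENNReal.ofReal, Real.toNNReal_of_nonneg ε.2.1]; rfl
  · simp

/-- With `f = n + k` the hypothesis reads `m ≤ n + 3k`: each flip beyond the first `n` pays for
three letters. -/
lemma pow_le_of_two_mul_add_le {ε : ℝ} (h0 : 0 ≤ ε) (h : ε < 1 / 6 ^ 3) {n m f : ℕ}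
    (h1 : 2 * n + m ≤ 3 * f) (h2 : f ≤ m) : ε ^ f ≤ (6 * ε) ^ n * (1 / 6) ^ m := by
  obtain ⟨k, rfl⟩ : ∃ k, f = n + k := ⟨f - n, by omega⟩
  calc ε ^ (n + k) = ε ^ n * ε ^ k := pow_add _ _ _
    _ ≤ ε ^ n * ((1 / 6) ^ 3) ^ k := by
      gcongr
      norm_num at h ⊢
      exact h.le
    _ ≤ ε ^ n * (6 ^ n * (1 / 6) ^ m) := by
      gcongr
      have e : (6 : ℝ) ^ n * (1 / 6) ^ (n + 3 * k) = ((1 / 6) ^ 3) ^ k := by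
        rw [pow_add, ← mul_assoc, ← mul_pow, ← pow_mul]; norm_num
      rw [← e]
      exact mul_le_mul_of_nonneg_left
        (pow_le_pow_of_le_one (by norm_num) (by norm_num) (by omega)) (by positivity)
    _ = (6 * ε) ^ n * (1 / 6) ^ m := by rw [mul_pow]; ring

/-- Union bound over the words that encode dual paths. -/
lemma historyLaw_le_of_exists_word {ε : unitInterval} (hε : (ε : ℝ) < 1 / 6 ^ 3)
    {E : Set (ℕ → Config X)} {n : ℕ} (hn : n ≠ 0) (S : List (Fin 3) → Finset (ℕ × X))
    (hE : ∀ F ∈ E, ∃ w : List (Fin 3), 2 * n + w.length ≤ 3 * (S w).card ∧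
      (S w).card ≤ w.length ∧ ∀ y ∈ S w, F y.1 y.2 = true) :
    historyLaw X ε E ≤ ENNReal.ofReal ((6 * (ε : ℝ)) ^ n) := by
  have h0 : (0 : ℝ) ≤ ε := ε.2.1
  let G (w : List (Fin 3)) : Set (ℕ → Config X) :=
    {F | (2 * n + w.length ≤ 3 * (S w).card ∧ (S w).card ≤ w.length) ∧
      ∀ y ∈ S w, F y.1 y.2 = true}
  have hG (w : List (Fin 3)) : historyLaw X ε (G w) ≤
      ENNReal.ofReal ((6 * (ε : ℝ)) ^ n * (1 / 6) ^ w.length) := by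
    by_cases hw : 2 * n + w.length ≤ 3 * (S w).card ∧ (S w).card ≤ w.length
    · have : G w = {F | ∀ y ∈ S w, F y.1 y.2 = true} := by ext F; simp [G, hw.1, hw.2]
      rw [this, historyLaw_forall_mem]
      exact ENNReal.ofReal_le_ofReal (pow_le_of_two_mul_add_le h0 hε hw.1 hw.2)
    · have : G w = ∅ := by
        ext F
        simp only [G, Set.mem_ofPred_eq, Set.mem_empty_iff_false, iff_false]
        exact fun h => hw h.1
      simp [this]
  have hsub : E ⊆ ⋃ m : ℕ, ⋃ w : List.Vector (Fin 3) (m + 1), G w.toList := by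
    intro F hF
    obtain ⟨w, h1, h2, h3⟩ := hE F hF
    simp only [Set.mem_iUnion]
    -- The empty word is excluded by `n ≠ 0`; its term would spoil the constant.
    exact ⟨w.length - 1, ⟨w, by omega⟩, ⟨h1, h2⟩, h3⟩
  have hs := hasSum_geometric_two' ((6 * (ε : ℝ)) ^ n)
  calc historyLaw X ε E
      ≤ ∑' m : ℕ, historyLaw X ε (⋃ w : List.Vector (Fin 3) (m + 1), G w.toList) :=
        (measure_mono hsub).trans (measure_iUnion_le _)
    _ ≤ ∑' m : ℕ, ENNReal.ofReal ((6 * (ε : ℝ)) ^ n / 2 / 2 ^ m) := by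
        refine ENNReal.tsum_le_tsum fun m => ?_
        calc historyLaw X ε (⋃ w : List.Vector (Fin 3) (m + 1), G w.toList)
            ≤ ∑ w : List.Vector (Fin 3) (m + 1), historyLaw X ε (G w.toList) :=
              measure_iUnion_fintype_le _ _
          _ ≤ ∑ _w : List.Vector (Fin 3) (m + 1),
                ENNReal.ofReal ((6 * (ε : ℝ)) ^ n * (1 / 6) ^ (m + 1)) :=
              Finset.sum_le_sum fun w _ => by simpa using hG w.toList
          _ = ENNReal.ofReal ((6 * (ε : ℝ)) ^ n / 2 / 2 ^ m) := by
              rw [Finset.sum_const, Finset.card_univ, card_vector, Fintype.card_fin,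
                ← ENNReal.ofReal_nsmul, nsmul_eq_mul]
              congr 1
              push_cast
              have : (3 : ℝ) ^ (m + 1) * (1 / 6) ^ (m + 1) = 1 / 2 / 2 ^ m := by
                rw [← mul_pow, pow_succ, show (3 : ℝ) * (1 / 6) = 1 / 2 by norm_num, one_div_pow]; ring
              rw [mul_left_comm, this]; ring
    _ = ENNReal.ofReal ((6 * (ε : ℝ)) ^ n) := by
        rw [← ENNReal.ofReal_tsum_of_nonneg (fun m => by positivity) hs.summable, hs.tsum_eq]

end History

/-! ### The law of the automaton -/

section Law

variable {X : Type} [Ring X]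

lemma measurable_update : Measurable (update : Config X → Config X) :=
  measurable_pi_lambda _ fun x =>
    (measurable_of_countable fun p : Bool × Bool => min p.1 p.2).comp
      (g := fun p : Bool × Bool => min p.1 p.2) (f := fun b : Config X => (b x, b (x + 1)))
      ((measurable_pi_apply x).prodMk (measurable_pi_apply (x + 1)))

lemma measurable_max_config {X : Type} :
    Measurable fun (p : Config X × Config X) (x : X) => max (p.1 x) (p.2 x) :=
  measurable_pi_lambda _ fun x =>
    (measurable_of_countable fun p : Bool × Bool => max p.1 p.2).comp
      (g := fun p : Bool × Bool => max p.1 p.2)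
      (f := fun p : Config X × Config X => (p.1 x, p.2 x)) (((measurable_pi_apply x).comp measurable_fst).prodMk
        ((measurable_pi_apply x).comp measurable_snd))

lemma measurable_update_max :
    Measurable fun p : Config X × Config X => update fun x => max (p.1 x) (p.2 x) :=
  measurable_update.comp measurable_max_config

lemma measurable_evolve (t : ℕ) : Measurable fun F : ℕ → Config X => evolve F t := by
  induction t with
  | zero => exact measurable_const
  | succ t ih =>
    exact measurable_update_max.comp (ih.prodMk (measurable_pi_apply t))

lemma evolve_congr {F G : ℕ → Config X} {t : ℕ} (h : ∀ s < t, F s = G s) :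
    evolve F t = evolve G t := by
  induction t with
  | zero => rfl
  | succ t ih => simp only [evolve, ih fun s hs => h s (by omega), h t (by omega)]

/-- The state at time `t` is independent of the noise at time `t`. -/
lemma map_evolve_prodMk (ε : unitInterval) (t : ℕ) :
    (historyLaw X ε).map (fun F => (evolve F t, F t)) =
      ((historyLaw X ε).map fun F => evolve F t).prod (noiseLaw X ε) := by
  have hi : ProbabilityTheory.iIndepFun (fun (s : ℕ) (F : ℕ → Config X) => F s)
      (historyLaw X ε) :=
    ProbabilityTheory.iIndepFun_infinitePi (X := fun _ f => f) fun _ => measurable_id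
  have h := hi.indepFun_finset (Finset.range t) {t} (by simp) fun s => measurable_pi_apply s
  -- The state at time `t` only sees flips before `t`, so the default `false` is immaterial.
  let φ (r : Finset.range t → Config X) : Config X :=
    evolve (fun s => if hs : s ∈ Finset.range t then r ⟨s, hs⟩ else fun _ => false) t
  have hφ : Measurable φ := (measurable_evolve t).comp <| measurable_pi_lambda _ fun s => by
    by_cases hs : s ∈ Finset.range t
    · simpa [hs] using measurable_pi_apply _
    · simp [hs]
  let ψ (r : ({t} : Finset ℕ) → Config X) : Config X := r ⟨t, Finset.mem_singleton_self t⟩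
  have hψ : Measurable ψ := measurable_pi_apply _
  have h' := h.comp hφ hψ
  have e : (φ ∘ fun F (s : Finset.range t) => F s) = fun F : ℕ → Config X => evolve F t := by
    funext F
    exact evolve_congr fun s hs => by simp [hs]
  rw [e] at h'
  have := h'.map_prod_eq_prod_map_map (measurable_evolve t).aemeasurable
    (measurable_pi_apply t).aemeasurable
  refine this.trans ?_
  congr 1
  exact Measure.infinitePi_map_eval (fun _ : ℕ => noiseLaw X ε) t

lemma map_evolve_succ (ε : unitInterval) (t : ℕ) :
    (historyLaw X ε).map (fun F => evolve F (t + 1)) =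
      (((historyLaw X ε).map fun F => evolve F t).prod (noiseLaw X ε)).map
        fun p => update fun x => max (p.1 x) (p.2 x) := by
  rw [← map_evolve_prodMk, Measure.map_map measurable_update_max
    ((measurable_evolve t).prodMk (measurable_pi_apply t))]
  rfl

end Law

lemma chainLaw_eq_map (ε : unitInterval) (t : ℕ) :
    chainLaw ε t = (historyLaw ℤ ε).map fun F => evolve F t := by
  induction t with
  | zero =>
    have : (fun F : ℕ → Config ℤ => evolve F 0) = fun _ => errorsOn ∅ := by
      funext F x; simp [evolve, errorsOn]
    rw [this, Measure.map_const]
    simp [chainLaw]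
  | succ t ih =>
    rw [map_evolve_succ, ← ih, chainLaw, Function.iterate_succ_apply', ← chainLaw, chainKEps,
      chainNoise, Measure.map_map measurable_update measurable_max_config]
    rfl

/-! ### Matrix elements on the ring as probabilities. -/

lemma upGenerator_apply (ε : unitInterval) (b c : Bool) :
    (1 + (ε : ℝ) • upGenerator) b c =
      (ProbabilityTheory.bernoulliMeasure true false ε).real {y | max c y = b} := by
  classical
  rw [ProbabilityTheory.bernoulliMeasure_real_apply _ (Set.toFinite _).measurableSet]
  cases b <;> cases c <;>
    simp [upGenerator, sigmaPlus, sigmaMinus, Matrix.single, Matrix.mul_apply, sub_eq_add_neg]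

lemma ringNoise_apply {L : ℕ} [NeZero L] (ε : unitInterval) (d c : Config (ZMod L)) :
    ringNoise L ε d c = (noiseLaw (ZMod L) ε).real {f | (fun x => max (c x) (f x)) = d} := by
  have e : {f : Config (ZMod L) | (fun x => max (c x) (f x)) = d} =
      Set.pi (Finset.univ : Finset (ZMod L)) fun x => {y | max (c x) y = d x} := by
    ext f; simp [funext_iff, Set.mem_pi]
  rw [e, measureReal_def, noiseLaw,
    Measure.infinitePi_pi _ fun _ _ => (Set.toFinite _).measurableSet, ENNReal.toReal_prod]
  simp only [ringNoise, Matrix.of_apply, upGenerator_apply]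
  rfl

lemma ringKEps_apply {L : ℕ} [NeZero L] (ε : unitInterval) (b c : Config (ZMod L)) :
    ringKEps L ε b c =
      (noiseLaw (ZMod L) ε).real {f | update (fun x => max (c x) (f x)) = b} := by
  classical
  have hm : Measurable fun (f : Config (ZMod L)) (x : ZMod L) => max (c x) (f x) :=
    measurable_of_countable _
  have h (s : Set (Config (ZMod L))) :
      (noiseLaw (ZMod L) ε).real {f | (fun x => max (c x) (f x)) ∈ s} =
        ((noiseLaw (ZMod L) ε).map fun f x => max (c x) (f x)).real s := by
    rw [map_measureReal_apply hm (Set.toFinite s).measurableSet]; rfl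
  have e : {d : Config (ZMod L) | update d = b} =
      ((Finset.univ.filter fun d => b = update d : Finset _) : Set (Config (ZMod L))) := by
    ext; simp [eq_comm]
  have := h {d | update d = b}
  simp only [Set.mem_ofPred_eq] at this
  rw [this, e, ← sum_measureReal_singleton, ringKEps, Matrix.mul_apply, Finset.sum_filter]
  refine Finset.sum_congr rfl fun d _ => ?_
  rw [ringK, Matrix.of_apply, ringNoise_apply, ← h]
  simp

/-- Conditioning on the state before the last step turns the product measure into a matrix product.
-/
lemma ringKEps_pow_apply {L : ℕ} [NeZero L] (ε : unitInterval) (t : ℕ) (b : Config (ZMod L)) :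
    (ringKEps L ε ^ t) b (errorsOn ∅) =
      ((historyLaw (ZMod L) ε).map fun F => evolve F t).real {b} := by
  have h0 : (errorsOn ∅ : Config (ZMod L)) = fun _ => false := by funext x; simp [errorsOn]
  induction t generalizing b with
  | zero =>
    rw [pow_zero, Matrix.one_apply, h0]
    simp only [evolve, Measure.map_const, measure_univ, one_smul]
    rw [measureReal_def, Measure.dirac_apply]
    by_cases hb : b = fun _ => false
    · simp [hb]
    · simp [hb, Ne.symm hb]
  | succ t ih =>
    have : IsProbabilityMeasure ((historyLaw (ZMod L) ε).map fun F => evolve F t) :=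
      Measure.isProbabilityMeasure_map (measurable_evolve t).aemeasurable
    rw [pow_succ', Matrix.mul_apply, map_evolve_succ,
      map_measureReal_apply measurable_update_max (measurableSet_singleton b), measureReal_def,
      Measure.prod_apply (measurable_update_max (measurableSet_singleton b)), lintegral_fintype, ENNReal.toReal_sum]
    · refine Finset.sum_congr rfl fun c _ => ?_
      rw [ih, ringKEps_apply, ENNReal.toReal_mul]
      rfl
    · exact fun c _ => ENNReal.mul_ne_top (measure_ne_top _ _) (measure_ne_top _ _)

/-! ### The bounds -/

lemma ringKEps_pow_le (ε : unitInterval) (hε : (ε : ℝ) < 1 / 6 ^ 3) (t L : ℕ) [NeZero L]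
    (Λ : Finset (ZMod L)) (hΛ : Λ ≠ Finset.univ) :
    (ringKEps L ε ^ t) (errorsOn Λ) (errorsOn ∅) ≤ (6 * (ε : ℝ)) ^ Λ.card := by
  have h0 : (0 : ℝ) ≤ ε := ε.2.1
  rw [ringKEps_pow_apply, map_measureReal_apply (measurable_evolve t) (measurableSet_singleton _),
    measureReal_def]
  refine ENNReal.toReal_le_of_le_ofReal (by positivity) ?_
  rcases Λ.eq_empty_or_nonempty with rfl | hne
  · simp [prob_le_one]
  obtain ⟨x₀, hx₀⟩ : ∃ x, x ∉ Λ := by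
    by_contra! h
    exact hΛ (Finset.eq_univ_iff_forall.2 h)
  -- The window is one turn of the ring without the error-free site `x₀`, which lifts to `a - 1`.
  let a : ℤ := x₀.val + 1
  let I := Finset.Ico a (a + (L - 1 : ℕ))
  let V : Finset ℤ := I.filter fun x : ℤ => (x : ZMod L) ∉ Λ
  have hmem : ∀ x ∈ I \ V, (x : ZMod L) ∈ Λ := fun x hx => by
    simp only [V, Finset.mem_sdiff, Finset.mem_filter, not_and, not_not] at hx
    exact hx.2 hx.1
  have hcard : Λ.card ≤ (I \ V).card := by
    refine (Finset.card_le_card fun y hy => ?_).trans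
      (Finset.card_image_le (f := fun x : ℤ => (x : ZMod L)))
    have hL : (0 : ℤ) < L := by exact_mod_cast NeZero.pos L
    let k : ℤ := ((y.val : ℤ) - a) % L
    have hk : ((a + k : ℤ) : ZMod L) = y := by
      simp [k]
    have hk0 : 0 ≤ k := Int.emod_nonneg _ hL.ne'
    have hk1 : k < L := Int.emod_lt_of_pos _ hL
    -- The offset `L - 1` leads back to `x₀`.
    have hk2 : k ≠ L - 1 := fun h => hx₀ (by
      have : y = x₀ := by rw [← hk, h]; simp [a]
      exact this ▸ hy)
    refine Finset.mem_image.2 ⟨a + k, ?_, hk⟩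
    have hI : a + k ∈ I := Finset.mem_Ico.2 (by omega)
    simp [V, hI, hk, hy]
  refine historyLaw_le_of_exists_word hε hne.card_pos.ne' (crossedSites (ZMod L) V t a)
    fun F hF => ?_
  have hF' : evolve F t = errorsOn Λ := hF
  obtain ⟨w, h1, h2, h3⟩ := exists_word_ring (L := L) (F := F) (t := t) (a := a) (V := V)
    (Finset.filter_subset _ _) (fun x hx => by rw [hF']; simpa [errorsOn] using hmem x hx)
    (by rw [hF']; simpa [errorsOn, a] using hx₀)
  exact ⟨w, le_trans (by gcongr) h1, h2, h3⟩

lemma chainLaw_forall_mem_le (ε : unitInterval) (hε : (ε : ℝ) < 1 / 6 ^ 3) (t : ℕ)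
    (Λ : Finset ℤ) :
    chainLaw ε t {b | ∀ x ∈ Λ, b x = true} ≤ ENNReal.ofReal ((6 * (ε : ℝ)) ^ Λ.card) := by
  have hm : MeasurableSet {b : Config ℤ | ∀ x ∈ Λ, b x = true} := by
    have : {b : Config ℤ | ∀ x ∈ Λ, b x = true} = Set.pi Λ fun _ => {true} := by
      ext; simp [Set.mem_pi]
    rw [this]
    exact MeasurableSet.pi Λ.countable_toSet fun _ _ => measurableSet_singleton _
  rw [chainLaw_eq_map, Measure.map_apply (measurable_evolve t) hm]
  rcases Λ.eq_empty_or_nonempty with rfl | hne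
  · simp
  have hI : Λ ⊆ Finset.Ico (Λ.min' hne) (Λ.min' hne + (Λ.max' hne - Λ.min' hne + 1).toNat) := by
    intro x hx
    have h1 := Λ.min'_le x hx
    have h2 := Λ.le_max' x hx
    rw [Finset.mem_Ico]
    omega
  exact historyLaw_le_of_exists_word hε hne.card_pos.ne' (crossedSites ℤ _ t _)
    fun F hF => exists_word_chain hI hF

end Stavskaya
end

theorem mainTheorem2 (ε : unitInterval) (hε : (ε : ℝ) < 1 / 6 ^ 3) (t : ℕ) :
    (∀ (L : ℕ) [NeZero L] (Λ : Finset (ZMod L)), Λ ≠ Finset.univ →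
      (Stavskaya.ringKEps L ε ^ t) (Stavskaya.errorsOn Λ) (Stavskaya.errorsOn ∅)
        ≤ (6 * (ε : ℝ)) ^ Λ.card) ∧
    (∀ Λ : Finset ℤ,
      Stavskaya.chainLaw ε t {Stavskaya.errorsOn Λ} ≤ ENNReal.ofReal ((6 * (ε : ℝ)) ^ Λ.card)) ∧
    (∀ Λ : Finset ℤ,
      Stavskaya.chainLaw ε t {b | ∀ x ∈ Λ, b x = true}
        ≤ ENNReal.ofReal ((6 * (ε : ℝ)) ^ Λ.card)) := by
  refine ⟨fun L _ Λ hΛ => Stavskaya.ringKEps_pow_le ε hε t L Λ hΛ, fun Λ => ?_,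
    Stavskaya.chainLaw_forall_mem_le ε hε t⟩
  refine (measure_mono ?_).trans (Stavskaya.chainLaw_forall_mem_le ε hε t Λ)
  rintro b rfl x hx
  simpa [Stavskaya.errorsOn] using hx
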